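/- Let $X$ be a connected, locally path connected space with a base point $x$. A covering is a surjective covering map. For an open cover $\mathcal U$ of $X$ and $y\in X$ let $\pi(\mathcal U,y)\le\pi_1(X,y)$ be the subgroup of all finite products of classes $[\alpha*\beta*\alpha^{-1}]$, where $\alpha$ is a path starting at $y$ and $\beta$ is a loop at the end point of $\alpha$ lying inside one member of $\mathcal U$; let $\pi_1^{sp}(X,y)=\bigcap_{\mathcal U}\pi(\mathcal U,y)$, the intersection over all open covers of $X$. Let $\pi_1^{qtop}(X,x)$ be $\pi_1(X,x)$ with the quotient of the compact-open topology on the space of loops at $x$ (the quasitopological fundamental group), and let $\pi_1^{\tau}(X,x)$ be $\pi_1(X,x)$ with the finest group topology for which the canonical map from the loop space is continuous. Then the following are equivalent. (i) $X$ is coverable: for every subgroup $H\le\pi_1(X,x)$ with $\pi_1^{sp}(X,x)\le H$ there are a covering $p:\widetilde X\to X$ and a point $\tilde x\in p^{-1}(x)$ with $p_*\pi_1(\widetilde X,\tilde x)=H$. (ii) $X$ has a (categorical) universal covering: a covering $p:\widetilde X\to X$ such that for every covering $q:\widetilde Y\to X$ with $\widetilde Y$ path connected there is a covering $f:\widetilde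 X\to\widetilde Y$ with $q\circ f=p$, and any two such $f,f'$ are equivalent, i.e. $f'\circ h=f$ for some homeomorphism $h:\widetilde X\to\widetilde X$. (iii) $X$ has a $\pi$-stable open cover: an open cover $\mathcal U$ such that $\pi(\mathcal U,y)=\pi(\mathcal V,y)$ for every open cover $\mathcal V$ refining $\mathcal U$ and every $y\in X$. (iv) $X$ is semi-locally Spanier: every $y\in X$ has an open neighborhood $U$ with $i_*\pi_1(U,y)\le\pi_1^{sp}(X,y)$, where $i:U\hookrightarrow X$ is the inclusion. (v) $X$ has no wild point. Here $y\in X$ is regular if it has an open neighborhood $U$ with $i_*\pi_1(U,y)=1$ in $\pi_1(X,y)$, and wild if it is not regular and every open neighborhood $U$ of $y$ contains a loop $\alpha$ at $y$ with $[\alpha]\notin\pi_1^{sp}(X,y)$. (vi) $\pi_1^{sp}(X,x)$ is open in $\pi_1^{qtop}(X,x)$. (vii) $\pi_1^{sp}(X,x)$ is open in $\pi_1^{\tau}(X,x)$. -/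

import Mathlib

open scoped Topology

universe u

namespace SpanierCovering

/-- A family of subsets that is an open cover of `X`. -/
def IsOpenCovering {X : Type u} [TopologicalSpace X] (𝒰 : Set (Set X)) : Prop :=
  (∀ U ∈ 𝒰, IsOpen U) ∧ ⋃₀ 𝒰 = Set.univ

/-- `𝒱` refines `𝒰`: every member of `𝒱` lies in some member of `𝒰`. -/
def Refines {X : Type u} (𝒱 𝒰 : Set (Set X)) : Prop :=
  ∀ V ∈ 𝒱, ∃ U ∈ 𝒰, V ⊆ U

/-- The class in `π₁(X, x)` of a loop at `x`. -/
def loopClass {X : Type u} [TopologicalSpace X] {x : X} (γ : Path x x) : FundamentalGroup X x :=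
  FundamentalGroup.fromPath (Path.Homotopic.Quotient.mk γ)

/-- The Spanier group `π(𝒰, x)`: the subgroup of `π₁(X, x)` of all finite products of classes
`[α * β * α⁻¹]`, with `α` a path starting at `x` and `β` a loop at the end of `α` that stays
inside one member of `𝒰`. -/
noncomputable def spanierGroupOf {X : Type u} [TopologicalSpace X] (𝒰 : Set (Set X)) (x : X) :
    Subgroup (FundamentalGroup X x) :=
  Subgroup.closure {g | ∃ (y : X) (α : Path x y) (β : Path y y),
    (∃ U ∈ 𝒰, Set.range β ⊆ U) ∧ g = loopClass ((α.trans β).trans α.symm)}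

/-- The Spanier group `π₁ˢᵖ(X, x)`: the intersection of `π(𝒰, x)` over all open covers `𝒰`. -/
noncomputable def spanierGroup {X : Type u} [TopologicalSpace X] (x : X) : Subgroup (FundamentalGroup X x) :=
  ⨅ (𝒰 : Set (Set X)) (_ : IsOpenCovering 𝒰), spanierGroupOf 𝒰 x

/-- An open cover `𝒰` is `π`-stable if passing to an open refinement never changes the
Spanier group, at any base point. -/
def IsPiStable {X : Type u} [TopologicalSpace X] (𝒰 : Set (Set X)) : Prop :=
  IsOpenCovering 𝒰 ∧ ∀ 𝒱 : Set (Set X), IsOpenCovering 𝒱 → Refines 𝒱 𝒰 →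
    ∀ y : X, spanierGroupOf 𝒰 y = spanierGroupOf 𝒱 y

/-- Covering maps in the usual sense; Mathlib's `IsCoveringMap` allows empty fibers, so
surjectivity is added. -/
def IsCovering {E B : Type u} [TopologicalSpace E] [TopologicalSpace B] (p : C(E, B)) : Prop :=
  IsCoveringMap p ∧ Function.Surjective p

/-- There is a covering `p : E → X` with `p_* π₁(E, e) = H` for some `e` over `x`. -/
def HasCoveringWithImage {X : Type u} [TopologicalSpace X] (x : X)
    (H : Subgroup (FundamentalGroup X x)) : Prop :=
  ∃ (E : Type u) (_ : TopologicalSpace E) (p : C(E, X)) (e : E) (he : p e = x),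
    IsCovering p ∧ (FundamentalGroup.mapOfEq p he).range = H

/-- Coverable: every subgroup containing the Spanier group is the image of a covering. -/
def IsCoverable {X : Type u} [TopologicalSpace X] (x : X) : Prop :=
  ∀ H : Subgroup (FundamentalGroup X x), spanierGroup x ≤ H → HasCoveringWithImage x H

/-- A (categorical) universal covering: a covering `p : E → X` such that for every covering
`q : Y → X` with `Y` path connected there is a covering `f : E → Y` with `q ∘ f = p`, unique up to
equivalence of coverings of `Y`. -/
def IsUniversalCovering {E X : Type u} [TopologicalSpace E] [TopologicalSpace X]
    (p : C(E, X)) : Prop :=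
  IsCovering p ∧
    ∀ (Y : Type u) [TopologicalSpace Y] [PathConnectedSpace Y] (q : C(Y, X)), IsCovering q →
      (∃ f : C(E, Y), IsCovering f ∧ q.comp f = p) ∧
      ∀ f f' : C(E, Y), IsCovering f → IsCovering f' → q.comp f = p → q.comp f' = p →
        ∃ h : E ≃ₜ E, ∀ e : E, f' (h e) = f e

/-- `X` has a categorical universal covering. -/
def HasUniversalCovering (X : Type u) [TopologicalSpace X] : Prop :=
  ∃ (E : Type u) (_ : TopologicalSpace E) (p : C(E, X)), IsUniversalCovering p

/-- The image `i_* π₁(U, y)` in `π₁(X, y)`, with `i : U → X` the inclusion. -/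
noncomputable def inclusionImage {X : Type u} [TopologicalSpace X] (U : Set X) (y : X) (hy : y ∈ U) :
    Subgroup (FundamentalGroup X y) :=
  (FundamentalGroup.mapOfEq (x := (⟨y, hy⟩ : U)) (y := y)
    (⟨Subtype.val, continuous_subtype_val⟩ : C(U, X)) rfl).range

/-- Semi-locally Spanier spaces. -/
def IsSemilocallySpanier (X : Type u) [TopologicalSpace X] : Prop :=
  ∀ y : X, ∃ (U : Set X) (hy : y ∈ U), IsOpen U ∧ inclusionImage U y hy ≤ spanierGroup y

/-- Regular points: those at which `X` is semi-locally simply connected. -/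
def IsRegularPoint {X : Type u} [TopologicalSpace X] (y : X) : Prop :=
  ∃ (U : Set X) (hy : y ∈ U), IsOpen U ∧ inclusionImage U y hy = ⊥

/-- Wild points: non-regular points `y` such that every open neighborhood of `y` contains a loop
at `y` whose class is not in the Spanier group. -/
def IsWildPoint {X : Type u} [TopologicalSpace X] (y : X) : Prop :=
  ¬ IsRegularPoint y ∧ ∀ U : Set X, IsOpen U → y ∈ U →
    ∃ α : Path y y, Set.range α ⊆ U ∧ loopClass α ∉ spanierGroup y

/-- The topology of the quasitopological fundamental group: the quotient of the compact-open
topology on the space of loops at `x`. -/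
abbrev quotientTopology {X : Type u} [TopologicalSpace X] (x : X) :
    TopologicalSpace (FundamentalGroup X x) :=
  TopologicalSpace.coinduced (loopClass : Path x x → FundamentalGroup X x) Path.instTopologicalSpace

/-- The topology of `π₁^τ(X, x)`: the finest group topology on `π₁(X, x)` for which
the map from the loop space is continuous. -/
noncomputable def groupTopology {X : Type u} [TopologicalSpace X] (x : X) :
    GroupTopology (FundamentalGroup X x) :=
  GroupTopology.coinduced (loopClass : Path x x → FundamentalGroup X x)

end SpanierCovering

/-!
# Coverable spaces and the Spanier group

For a connected, locally path connected space, the existence of coverings for all subgroups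
containing the Spanier group, the existence of a categorical universal covering, and several local
and topological conditions on the Spanier group are equivalent. All of them are compared with the
existence of an open cover whose Spanier group is the Spanier group of the space. The covering
spaces are glued from products of small open sets with sets of cosets of the fundamental group.
-/

namespace SpanierCovering

open Path.Homotopic

/-! ### Change of base point and Spanier groups -/

variable {X : Type u} [TopologicalSpace X] {x y z : X}

/-! Everything reduces to one condition (*): some open cover `𝒰` satisfies `π(𝒰, x) ≤ π₁ˢᵖ(X, x)`.
Spanier groups are carried into one another by change of base point, so they are normal and (*) does
not depend on `x`; this settles π-stability and the semi-locally Spanier condition, and the wild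
point condition is a reformulation of the latter.

Two facts link (*) to coverings. A covering trivialized over the members of `𝒰` has a group
containing `π(𝒰, x)`, because loops inside a member lift to loops
(`exists_isOpenCovering_spanierGroupOf_le`). Conversely, every `H ≥ π(𝒰, x)` is the group of a path
connected covering, whose points are classes of paths from `x` modulo `H`
(`exists_covering_of_spanierGroupOf_le`). Hence (*) says exactly that `π₁ˢᵖ(X, x)` is the group of a
covering. That covering lies over all others and is universal.

For the topologies, the loops whose lift closes up form an open set, since fibers are discrete; and
a loop near the constant one is merely a loop inside a small neighborhood. -/

theorem loopClass_surjective : Function.Surjective (loopClass (x := x)) :=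
  Path.Homotopic.Quotient.mk_surjective

/-- Change of base point along a homotopy class of paths `a` from `x` to `y`: the isomorphism
`π₁(X, y) ≃* π₁(X, x)` sending `g` to `a * g * a⁻¹`. -/
noncomputable def transport (a : Path.Homotopic.Quotient x y) :
    FundamentalGroup X y ≃* FundamentalGroup X x where
  toFun g := (a.trans g).trans a.symm
  invFun g := (a.symm.trans g).trans a
  left_inv g := by
    change (a.symm.trans ((a.trans g).trans a.symm)).trans a = g
    rw [Quotient.trans_assoc, Quotient.trans_assoc, Quotient.symm_trans, Quotient.trans_refl,
      ← Quotient.trans_assoc, Quotient.symm_trans, Quotient.refl_trans]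
  right_inv g := by
    change (a.trans ((a.symm.trans g).trans a)).trans a.symm = g
    rw [Quotient.trans_assoc, Quotient.trans_assoc, Quotient.trans_symm, Quotient.trans_refl,
      ← Quotient.trans_assoc, Quotient.trans_symm, Quotient.refl_trans]
  map_mul' g h := by
    change (a.trans (h.trans g)).trans a.symm =
      ((a.trans h).trans a.symm).trans ((a.trans g).trans a.symm)
    simp only [Quotient.trans_assoc]
    rw [← Quotient.trans_assoc a.symm a, Quotient.symm_trans, Quotient.refl_trans]

theorem transport_apply (a : Path.Homotopic.Quotient x y) (g : FundamentalGroup X y) :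
    transport a g = (a.trans g).trans a.symm := rfl

theorem transport_trans (a : Path.Homotopic.Quotient x y) (b : Path.Homotopic.Quotient y z)
    (g : FundamentalGroup X z) : transport a (transport b g) = transport (a.trans b) g := by
  induction a with | mk a => ?_
  induction b with | mk b => ?_
  simp only [transport_apply, ← Quotient.mk_trans, ← Quotient.mk_symm, Path.trans_symm]
  simp only [Quotient.mk_trans, Quotient.mk_symm, Quotient.trans_assoc]

theorem transport_refl (g : FundamentalGroup X x) : transport (.refl x) g = g := by
  rw [transport_apply, ← Quotient.mk_refl, ← Quotient.mk_symm, Path.refl_symm, Quotient.mk_refl,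
    Quotient.trans_refl, Quotient.refl_trans]

theorem transport_symm_apply (a : Path.Homotopic.Quotient x y) (g : FundamentalGroup X y) :
    transport a.symm (transport a g) = g := by
  rw [transport_trans, Quotient.symm_trans, transport_refl]

/-- In `FundamentalGroup` the right factor of a product is traversed first, which puts the inverse
on the left. -/
theorem transport_loop (a g : FundamentalGroup X x) :
    transport (x := x) (y := x) a g = a⁻¹ * g * a := by
  change (Quotient.trans a g).trans (Quotient.symm a) =
    Quotient.trans a (Quotient.trans g (Quotient.symm a))
  rw [Quotient.trans_assoc]

theorem transport_mem_spanierGroupOf {𝒰 : Set (Set X)} (a : Path.Homotopic.Quotient x y)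
    {g : FundamentalGroup X y} (hg : g ∈ spanierGroupOf 𝒰 y) :
    transport a g ∈ spanierGroupOf 𝒰 x := by
  suffices spanierGroupOf 𝒰 y ≤ (spanierGroupOf 𝒰 x).comap (transport a).toMonoidHom from this hg
  refine (Subgroup.closure_le _).mpr ?_
  rintro _ ⟨z, α, β, hβ, rfl⟩
  induction a with | mk a => ?_
  refine Subgroup.subset_closure ⟨z, a.trans α, β, hβ, ?_⟩
  exact transport_trans (.mk a) (.mk α) (loopClass β)

theorem transport_mem_spanierGroup (a : Path.Homotopic.Quotient x y)
    {g : FundamentalGroup X y} (hg : g ∈ spanierGroup y) : transport a g ∈ spanierGroup x := by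
  simp only [spanierGroup, Subgroup.mem_iInf] at hg ⊢
  exact fun 𝒰 h𝒰 ↦ transport_mem_spanierGroupOf a (hg 𝒰 h𝒰)

theorem transport_mem_spanierGroup_iff (a : Path.Homotopic.Quotient x y)
    {g : FundamentalGroup X y} : transport a g ∈ spanierGroup x ↔ g ∈ spanierGroup y :=
  ⟨fun h ↦ transport_symm_apply a g ▸ transport_mem_spanierGroup a.symm h,
    transport_mem_spanierGroup a⟩

instance spanierGroupOf_normal (𝒰 : Set (Set X)) (x : X) : (spanierGroupOf 𝒰 x).Normal where
  conj_mem n hn g := by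
    simpa only [transport_loop, inv_inv] using
      transport_mem_spanierGroupOf (x := x) (y := x) (g⁻¹ : FundamentalGroup X x) hn

instance spanierGroup_normal (x : X) : (spanierGroup x).Normal where
  conj_mem n hn g := by
    simpa only [transport_loop, inv_inv] using
      transport_mem_spanierGroup (x := x) (y := x) (g⁻¹ : FundamentalGroup X x) hn

theorem spanierGroup_le {𝒰 : Set (Set X)} (h𝒰 : IsOpenCovering 𝒰) (x : X) :
    spanierGroup x ≤ spanierGroupOf 𝒰 x :=
  iInf₂_le 𝒰 h𝒰

theorem spanierGroupOf_mono {𝒰 𝒱 : Set (Set X)} (h : Refines 𝒱 𝒰) (x : X) :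
    spanierGroupOf 𝒱 x ≤ spanierGroupOf 𝒰 x := by
  refine Subgroup.closure_mono ?_
  rintro _ ⟨y, α, β, ⟨V, hV, hβ⟩, rfl⟩
  obtain ⟨U, hU, hVU⟩ := h V hV
  exact ⟨y, α, β, ⟨U, hU, hβ.trans hVU⟩, rfl⟩

theorem transport_loopClass_mem {𝒰 : Set (Set X)} (a : Path.Homotopic.Quotient x y) (β : Path y y)
    {U : Set X} (hU : U ∈ 𝒰) (hβ : Set.range β ⊆ U) :
    transport a (loopClass β) ∈ spanierGroupOf 𝒰 x := by
  induction a with | mk a => ?_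
  exact Subgroup.subset_closure ⟨y, a, β, ⟨U, hU, hβ⟩, rfl⟩

theorem mem_inclusionImage {U : Set X} (hy : y ∈ U) {g : FundamentalGroup X y} :
    g ∈ inclusionImage U y hy ↔ ∃ β : Path y y, Set.range β ⊆ U ∧ loopClass β = g := by
  constructor
  · rintro ⟨γ, rfl⟩
    obtain ⟨γ, rfl⟩ := loopClass_surjective γ
    refine ⟨γ.map continuous_subtype_val, ?_, ?_⟩
    · rintro _ ⟨t, rfl⟩
      exact (γ t).2
    · rw [FundamentalGroup.mapOfEq_apply]
      rfl
  · rintro ⟨β, hβ, rfl⟩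
    let γ : Path (⟨y, hy⟩ : U) ⟨y, hy⟩ :=
      { toFun t := ⟨β t, hβ ⟨t, rfl⟩⟩
        source' := by simp
        target' := by simp }
    refine ⟨loopClass γ, ?_⟩
    rw [FundamentalGroup.mapOfEq_apply]
    rfl

theorem inclusionImage_le {U : Set X} (hy : y ∈ U) {K : Subgroup (FundamentalGroup X y)} :
    inclusionImage U y hy ≤ K ↔ ∀ β : Path y y, Set.range β ⊆ U → loopClass β ∈ K :=
  ⟨fun h β hβ ↦ h ((mem_inclusionImage hy).mpr ⟨β, hβ, rfl⟩), fun h _ hg ↦ by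
    obtain ⟨β, hβ, rfl⟩ := (mem_inclusionImage hy).mp hg
    exact h β hβ⟩

/-! ### Conditions on open covers and neighborhoods -/

theorem exists_isPiStable_iff [PathConnectedSpace X] (x : X) :
    (∃ 𝒰 : Set (Set X), IsPiStable 𝒰) ↔
      ∃ 𝒰 : Set (Set X), IsOpenCovering 𝒰 ∧ spanierGroupOf 𝒰 x ≤ spanierGroup x := by
  constructor
  · rintro ⟨𝒰, h𝒰, hst⟩
    refine ⟨𝒰, h𝒰, le_iInf₂ fun 𝒱 h𝒱 ↦ ?_⟩
    -- A common refinement: stability gives `π(𝒰) = π(𝒲)`, and `π(𝒲) ≤ π(𝒱)`.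
    let 𝒲 : Set (Set X) := Set.image2 (· ∩ ·) 𝒰 𝒱
    have h𝒲 : IsOpenCovering 𝒲 := by
      refine ⟨?_, Set.eq_univ_of_forall fun y ↦ ?_⟩
      · rintro _ ⟨U, hU, V, hV, rfl⟩
        exact (h𝒰.1 U hU).inter (h𝒱.1 V hV)
      · obtain ⟨U, hU, hyU⟩ := Set.mem_sUnion.mp (h𝒰.2.ge (Set.mem_univ y))
        obtain ⟨V, hV, hyV⟩ := Set.mem_sUnion.mp (h𝒱.2.ge (Set.mem_univ y))
        exact ⟨U ∩ V, ⟨U, hU, V, hV, rfl⟩, hyU, hyV⟩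
    rw [hst 𝒲 h𝒲 ?_ x]
    · refine spanierGroupOf_mono ?_ x
      rintro _ ⟨U, hU, V, hV, rfl⟩
      exact ⟨V, hV, Set.inter_subset_right⟩
    · rintro _ ⟨U, hU, V, hV, rfl⟩
      exact ⟨U, hU, Set.inter_subset_left⟩
  · rintro ⟨𝒰, h𝒰, hle⟩
    refine ⟨𝒰, h𝒰, fun 𝒱 h𝒱 href y ↦ le_antisymm (fun g hg ↦ ?_) (spanierGroupOf_mono href y)⟩
    have a : Path.Homotopic.Quotient x y := .mk (PathConnectedSpace.somePath x y)
    exact spanierGroup_le h𝒱 y <| (transport_mem_spanierGroup_iff a).mp <|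
      hle <| transport_mem_spanierGroupOf a hg

theorem isSemilocallySpanier_iff [PathConnectedSpace X] [LocallyPathConnectedSpace X] (x : X) :
    IsSemilocallySpanier X ↔
      ∃ 𝒰 : Set (Set X), IsOpenCovering 𝒰 ∧ spanierGroupOf 𝒰 x ≤ spanierGroup x := by
  constructor
  · intro h
    choose U hy hU hle using h
    -- Path components are taken so that a loop in a member, based at any `z`, is joined to `y`
    -- inside `U y`, where the hypothesis at `y` applies.
    refine ⟨Set.range fun y ↦ pathComponentIn (U y) y, ⟨?_, Set.eq_univ_of_forall fun y ↦ ?_⟩, ?_⟩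
    · rintro _ ⟨y, rfl⟩
      exact (hU y).pathComponentIn y
    · exact ⟨_, ⟨y, rfl⟩, mem_pathComponentIn_self (hy y)⟩
    · refine (Subgroup.closure_le _).mpr ?_
      rintro _ ⟨z, α, β, ⟨_, ⟨y, rfl⟩, hβ⟩, rfl⟩
      refine (transport_mem_spanierGroup_iff (g := loopClass β) (.mk α)).mpr ?_
      obtain ⟨δ, hδ⟩ : JoinedIn (U y) y z := hβ ⟨0, β.source⟩
      refine (transport_mem_spanierGroup_iff (.mk δ)).mp ?_
      refine (inclusionImage_le (hy y)).mp (hle y) ((δ.trans β).trans δ.symm) ?_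
      have hδ' : Set.range δ ⊆ U y := Set.range_subset_iff.mpr hδ
      simp only [Path.trans_range, Path.symm_range, Set.union_subset_iff]
      exact ⟨⟨hδ', hβ.trans pathComponentIn_subset⟩, hδ'⟩
  · rintro ⟨𝒰, h𝒰, hle⟩ y
    obtain ⟨U, hU, hyU⟩ := Set.mem_sUnion.mp (h𝒰.2.ge (Set.mem_univ y))
    refine ⟨U, hyU, h𝒰.1 U hU, (inclusionImage_le hyU).mpr fun β hβ ↦ ?_⟩
    have a : Path.Homotopic.Quotient x y := .mk (PathConnectedSpace.somePath x y)
    exact (transport_mem_spanierGroup_iff a).mp (hle (transport_loopClass_mem a β hU hβ))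

theorem isSemilocallySpanier_iff_forall_not_isWildPoint :
    IsSemilocallySpanier X ↔ ∀ y : X, ¬ IsWildPoint y := by
  constructor
  · rintro h y ⟨-, hw⟩
    obtain ⟨U, hy, hU, hle⟩ := h y
    obtain ⟨α, hα, hα'⟩ := hw U hU hy
    exact hα' ((inclusionImage_le hy).mp hle α hα)
  · intro h y
    by_cases hr : IsRegularPoint y
    · obtain ⟨U, hy, hU, hbot⟩ := hr
      exact ⟨U, hy, hU, hbot ▸ bot_le⟩
    · by_contra hns
      refine h y ⟨hr, fun U hU hy ↦ ?_⟩
      by_contra! hcon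
      exact hns ⟨U, hy, hU, (inclusionImage_le hy).mpr hcon⟩

/-! ### Coverings and monodromy -/

section Covering

variable {E : Type u} [TopologicalSpace E] {p : C(E, X)}

theorem monodromy_mk_eq (hp : IsCoveringMap p) {γ : Path x y} {e : p ⁻¹' {x}} {e' : p ⁻¹' {y}}
    (Γ : Path e.1 e'.1) (hΓ : ∀ t, p (Γ t) = γ t) : hp.monodromy (.mk γ) e = e' := by
  refine hp.monodromy_eq_of_map_eq (.mk Γ) (congrArg Path.Homotopic.Quotient.mk ?_)
  ext t
  exact hΓ t

theorem exists_lift (hp : IsCoveringMap p) (γ : Path x y) (e : p ⁻¹' {x}) :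
    ∃ Γ : Path e.1 (hp.monodromy (.mk γ) e).1, ∀ t, p (Γ t) = γ t :=
  ⟨⟨hp.liftPath γ e (γ.source.trans e.2.symm), hp.liftPath_zero .., rfl⟩,
    fun t ↦ congr_fun (hp.liftPath_lifts γ e (γ.source.trans e.2.symm)) t⟩

/-- Membership in the group of a covering becomes a fixed point condition: the lift starting at `e`
closes up. -/
theorem mem_range_mapOfEq_iff (hp : IsCoveringMap p) {e : E} (he : p e = x)
    {g : FundamentalGroup X x} :
    g ∈ (FundamentalGroup.mapOfEq p he).range ↔ hp.monodromy g ⟨e, he⟩ = ⟨e, he⟩ := by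
  obtain ⟨γ, rfl⟩ := loopClass_surjective g
  constructor
  · rintro ⟨Γ, hΓ⟩
    obtain ⟨Γ, rfl⟩ := loopClass_surjective Γ
    rw [FundamentalGroup.mapOfEq_apply] at hΓ
    rw [← hΓ]
    exact monodromy_mk_eq hp (γ := (Γ.map p.continuous).cast he.symm he.symm) Γ fun t ↦ rfl
  · intro h
    obtain ⟨Γ, hΓ⟩ := exists_lift hp γ ⟨e, he⟩
    refine ⟨loopClass (Γ.cast rfl congr($h.symm)), ?_⟩
    rw [FundamentalGroup.mapOfEq_apply]
    refine congrArg Path.Homotopic.Quotient.mk ?_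
    ext t
    exact hΓ t

theorem monodromy_symm_apply (hp : IsCoveringMap p) (a : Path.Homotopic.Quotient x y)
    (e : p ⁻¹' {x}) : hp.monodromy a.symm (hp.monodromy a e) = e := by
  rw [← hp.monodromy_trans_apply, Quotient.trans_symm, hp.monodromy_refl, id]

theorem monodromy_transport (hp : IsCoveringMap p) (a : Path.Homotopic.Quotient x y)
    (g : FundamentalGroup X y) (e : p ⁻¹' {x}) :
    hp.monodromy (transport a g) e = hp.monodromy a.symm (hp.monodromy g (hp.monodromy a e)) := by
  rw [transport_apply, hp.monodromy_trans_apply, hp.monodromy_trans_apply]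

/-- A covering trivializes an open cover: loops inside a member of the cover lift to loops. -/
theorem exists_isOpenCovering_spanierGroupOf_le (hp : IsCoveringMap p) :
    ∃ 𝒰 : Set (Set X), IsOpenCovering 𝒰 ∧ ∀ (x : X) (e : E) (he : p e = x),
      spanierGroupOf 𝒰 x ≤ (FundamentalGroup.mapOfEq p he).range := by
  refine ⟨{U | IsOpen U ∧ ∀ (y : X) (β : Path y y), Set.range β ⊆ U →
    ∀ e : p ⁻¹' {y}, hp.monodromy (.mk β) e = e}, ⟨fun U hU ↦ hU.1, ?_⟩, ?_⟩
  · refine Set.eq_univ_of_forall fun y ↦ ?_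
    obtain ⟨-, U, hyU, hU, -, H, hH⟩ := hp y
    refine ⟨U, ⟨hU, fun z β hβ e ↦ ?_⟩, hyU⟩
    have hz : z ∈ U := hβ ⟨0, β.source⟩
    have heU : p e.1 ∈ U := by rw [show p e.1 = z from e.2]; exact hz
    -- The lift of `β` keeps the fiber coordinate of `e` constant; `key` identifies both of its ends
    -- with `e`.
    have key : ∀ u : U, u.1 = z → (H.symm (u, (H ⟨e.1, heU⟩).2)).1 = e.1 := by
      rintro u hu
      have : u = (H ⟨e.1, heU⟩).1 := Subtype.ext (by rw [hu, hH]; exact e.2.symm)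
      rw [this]
      simp
    refine monodromy_mk_eq hp
      ⟨⟨fun t ↦ (H.symm (⟨β t, hβ ⟨t, rfl⟩⟩, (H ⟨e.1, heU⟩).2)).1, by fun_prop⟩, ?_, ?_⟩ fun t ↦ ?_
    · exact key _ β.source
    · exact key _ β.target
    · exact (hH _).symm.trans (by simp)
  · intro x e he
    refine (Subgroup.closure_le _).mpr ?_
    rintro _ ⟨y, α, β, ⟨U, hU, hβ⟩, rfl⟩
    refine (mem_range_mapOfEq_iff hp he).mpr ?_
    refine (monodromy_transport hp (.mk α) (loopClass β) _).trans ?_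
    rw [show hp.monodromy (loopClass β) _ = _ from hU.2 y β hβ _, monodromy_symm_apply]

theorem spanierGroup_le_range (hp : IsCoveringMap p) {e : E} (he : p e = x) :
    spanierGroup x ≤ (FundamentalGroup.mapOfEq p he).range := by
  obtain ⟨𝒰, h𝒰, hle⟩ := exists_isOpenCovering_spanierGroupOf_le hp
  exact (spanierGroup_le h𝒰 x).trans (hle x e he)

/-- For a path connected covering space whose group is normal, the group does not depend on the
point of the fiber. -/
theorem range_mapOfEq_eq_of_normal [PathConnectedSpace E] (hp : IsCoveringMap p)
    {N : Subgroup (FundamentalGroup X x)} [N.Normal] {e : E} (he : p e = x)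
    (h : (FundamentalGroup.mapOfEq p he).range = N) {e' : E} (he' : p e' = x) :
    (FundamentalGroup.mapOfEq p he').range = N := by
  let Γ := PathConnectedSpace.somePath e e'
  let γ : Path x x := (Γ.map p.continuous).cast he.symm he'.symm
  have hγ : hp.monodromy (.mk γ) ⟨e, he⟩ = ⟨e', he'⟩ := monodromy_mk_eq hp Γ fun t ↦ rfl
  ext g
  -- Conjugation by `γ` exchanges the stabilizers of `e` and `e'`, and normality makes it preserve
  -- `N`.
  have hN : g ∈ N ↔ transport (.mk γ) g ∈ N := by
    rw [show transport (.mk γ) g = _ from transport_loop (loopClass γ) g]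
    refine ⟨fun hg ↦ Subgroup.Normal.conj_mem' inferInstance g hg _, fun hg ↦ ?_⟩
    simpa only [mul_assoc, mul_inv_cancel_left, mul_inv_cancel, mul_one] using
      Subgroup.Normal.conj_mem inferInstance _ hg (loopClass γ)
  rw [hN, ← h, mem_range_mapOfEq_iff hp, mem_range_mapOfEq_iff hp, monodromy_transport, hγ]
  constructor
  · intro hg
    rw [hg, ← hγ, monodromy_symm_apply]
  · intro hg
    refine (hp.monodromy_bijective (Path.Homotopic.Quotient.mk γ).symm).1 (hg.trans ?_)
    rw [← hγ, monodromy_symm_apply]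

/-- Lifting the evaluation map, with the loop as parameter, makes the end of the lift depend
continuously on the loop; the fiber being discrete, ending at `e` is an open condition. -/
theorem isOpen_setOf_loopClass_mem_range (hp : IsCoveringMap p) {e : E} (he : p e = x) :
    IsOpen {γ : Path x x | loopClass γ ∈ (FundamentalGroup.mapOfEq p he).range} := by
  let H : C(unitInterval × Path x x, X) := ⟨fun q ↦ q.2 q.1, by fun_prop⟩
  have H_0 : ∀ γ : Path x x, H (0, γ) = p (ContinuousMap.const (Path x x) e γ) :=
    fun γ ↦ γ.source.trans he.symm
  have hend : ∀ γ : Path x x,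
      hp.liftHomotopy H (.const _ e) H_0 (1, γ) = (hp.monodromy (.mk γ) ⟨e, he⟩).1 := fun γ ↦ rfl
  have hcont : Continuous fun γ : Path x x ↦ hp.monodromy (.mk γ) ⟨e, he⟩ :=
    continuous_induced_rng.mpr <|
      ((hp.liftHomotopy H (.const _ e) H_0).continuous.comp (Continuous.prodMk_right 1)).congr hend
  have := (hp x).discreteTopology_fiber
  convert (isOpen_discrete {(⟨e, he⟩ : p ⁻¹' {x})}).preimage hcont using 1
  ext γ
  exact mem_range_mapOfEq_iff hp he

theorem locallyPathConnectedSpace_of_isLocalHomeomorph [LocallyPathConnectedSpace X]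
    (hp : IsLocalHomeomorph p) : LocallyPathConnectedSpace E := by
  let _ : ChartedSpace X E :=
    { atlas := Set.univ
      chartAt e := (hp e).choose
      mem_chart_source e := (hp e).choose_spec.1
      chart_mem_atlas _ := Set.mem_univ _ }
  exact ChartedSpace.locallyPathConnectedSpace X E

end Covering

/-! ### Maps between coverings -/

section Comp

variable {E Y : Type u} [TopologicalSpace E] [TopologicalSpace Y] {p : C(E, X)} {q : C(Y, X)}
  {f : C(E, Y)}

/-- A path in `Y` from `f e` to `y` is projected to `X` and lifted to `E`; by uniqueness of lifts,
`f` maps the end of that lift to `y`. -/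
theorem surjective_of_comp_eq [Nonempty E] [PathConnectedSpace Y] (hp : IsCoveringMap p)
    (hq : IsCoveringMap q) (h : q.comp f = p) : Function.Surjective f := by
  intro y
  obtain ⟨e⟩ := ‹Nonempty E›
  have h' : ∀ e, q (f e) = p e := fun e ↦ congr($h e)
  let Δ := PathConnectedSpace.somePath (f e) y
  let γ : Path (p e) (q y) := (Δ.map q.continuous).cast (h' e).symm rfl
  obtain ⟨Γ, hΓ⟩ := exists_lift hp γ ⟨e, rfl⟩
  have h1 : hq.monodromy (.mk γ) ⟨f e, h' e⟩ = ⟨y, rfl⟩ := monodromy_mk_eq hq Δ fun t ↦ rfl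
  have h2 : hq.monodromy (.mk γ) ⟨f e, h' e⟩ = ⟨f (hp.monodromy (.mk γ) ⟨e, rfl⟩).1, (h' _).trans
      (hp.monodromy (.mk γ) ⟨e, rfl⟩).2⟩ :=
    monodromy_mk_eq hq (Γ.map f.continuous) fun t ↦ (h' _).trans (hΓ t)
  exact ⟨_, congr(($(h2.symm.trans h1)).1)⟩

/-- Over a path connected open `W` trivializing both coverings, `f` maps each sheet of `E` onto one
sheet of `Y`. The preimage of the sheet `V` through `y` is therefore a union of sheets, indexed by
`J`. -/
theorem isCoveringMap_of_comp_eq [LocallyPathConnectedSpace X] (hp : IsCoveringMap p)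
    (hq : IsCoveringMap q) (h : q.comp f = p) (hf : Function.Surjective f) : IsCoveringMap f := by
  intro y
  have h' : ∀ e, q (f e) = p e := fun e ↦ congr($h e)
  obtain ⟨e₀, he₀⟩ := hf y
  have : Nonempty (p ⁻¹' {q y}) := ⟨e₀, by rw [← he₀]; exact (h' e₀).symm⟩
  have : Nonempty (q ⁻¹' {q y}) := ⟨y, rfl⟩
  have := (hp (q y)).discreteTopology_fiber
  have := (hq (q y)).discreteTopology_fiber
  let s := (hp (q y)).toTrivialization
  let t := (hq (q y)).toTrivialization
  obtain ⟨W, ⟨hWo, hyW, hWc⟩, hW⟩ := (isOpen_isPathConnected_basis (q y)).mem_iff.mp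
    ((s.open_baseSet.inter t.open_baseSet).mem_nhds
      ⟨(hp (q y)).mem_toTrivialization_baseSet, (hq (q y)).mem_toTrivialization_baseSet⟩)
  change W ⊆ _ at hW
  let A := s.preimageHomeomorph (hW.trans Set.inter_subset_left)
  let B := t.preimageHomeomorph (hW.trans Set.inter_subset_right)
  have hA : ∀ e, ((A e).1 : X) = p e.1 := fun e ↦ by
    rw [Bundle.Trivialization.preimageHomeomorph_apply]
  have hB : ∀ z, ((B z).1 : X) = q z.1 := fun e ↦ by
    rw [Bundle.Trivialization.preimageHomeomorph_apply]
  clear_value A B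
  have hAs : ∀ w, p (A.symm w).1 = w.1 := fun w ↦ by rw [← hA, A.apply_symm_apply]
  let F : p ⁻¹' W → q ⁻¹' W := fun e ↦ ⟨f e.1, by rw [Set.mem_preimage, h']; exact e.2⟩
  have hF : Continuous F := by fun_prop
  have : PreconnectedSpace W := isPreconnected_iff_preconnectedSpace.mp
    hWc.isConnected.isPreconnected
  let w₀ : W := ⟨q y, hyW⟩
  -- the sheet of `Y` containing `f e` depends only on the sheet of `E` containing `e`
  have hsheet : ∀ (i : p ⁻¹' {q y}) (w w' : W), (B (F (A.symm (w, i)))).2 =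
      (B (F (A.symm (w', i)))).2 := fun i w w' ↦
    PreconnectedSpace.constant inferInstance
      (f := fun w ↦ (B (F (A.symm (w, i)))).2) (by fun_prop)
  let j := (B ⟨y, hyW⟩).2
  let V : Set Y := Subtype.val '' {z : q ⁻¹' W | (B z).2 = j}
  have hV : IsOpen V := (hWo.preimage q.continuous).isOpenMap_subtype_val _ <|
    (isOpen_discrete {j}).preimage (continuous_snd.comp B.continuous)
  have hVW : ∀ z : Y, z ∈ V ↔ ∃ hz : q z ∈ W, (B ⟨z, hz⟩).2 = j := fun z ↦ by
    constructor
    · rintro ⟨z, hz, rfl⟩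
      exact ⟨z.2, hz⟩
    · rintro ⟨hz, hz'⟩
      exact ⟨⟨z, hz⟩, hz', rfl⟩
  have hVq : ∀ z ∈ V, q z ∈ W := fun z hz ↦ ((hVW z).mp hz).1
  have hVp : ∀ e, f e ∈ V → p e ∈ W := fun e he ↦ h' e ▸ hVq _ he
  let J : Set (p ⁻¹' {q y}) := {i | (B (F (A.symm (w₀, i)))).2 = j}
  have hJ : ∀ e (he : p e ∈ W), (B (F (A.symm (w₀, (A ⟨e, he⟩).2)))).2 = (B (F ⟨e, he⟩)).2 := by
    intro e he
    rw [hsheet _ w₀ (A ⟨e, he⟩).1]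
    simp
  have hinv : ∀ (v : V) (i : J), f (A.symm (⟨q v.1, hVq v.1 v.2⟩, i.1)).1 = v.1 := by
    intro v i
    have : F (A.symm (⟨q v.1, hVq v.1 v.2⟩, i.1)) = ⟨v.1, hVq v.1 v.2⟩ := by
      refine B.injective (Prod.ext (Subtype.ext ?_) ?_)
      · rw [hB, hB]
        exact (h' _).trans (hAs _)
      · rw [hsheet i.1 _ w₀, i.2]
        obtain ⟨_, hv⟩ := (hVW v.1).mp v.2
        exact hv.symm
    exact congr(($this).1)
  refine IsEvenlyCovered.to_isEvenlyCovered_preimage (I := J) ⟨inferInstance, V,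
    (hVW y).mpr ⟨hyW, rfl⟩, hV, hV.preimage f.continuous, ?_, ?_⟩
  · exact
      { toFun e := (⟨f e.1, e.2⟩, ⟨(A ⟨e.1, hVp _ e.2⟩).2, by
          obtain ⟨_, hv⟩ := (hVW _).mp e.2
          exact (hJ _ _).trans hv⟩)
        invFun v := ⟨(A.symm (⟨q v.1.1, hVq _ v.1.2⟩, v.2.1)).1, by
          rw [Set.mem_preimage, hinv]
          exact v.1.2⟩
        left_inv e := by
          refine Subtype.ext ?_
          have : ((⟨q (f e.1), hVq _ e.2⟩ : W), (A ⟨e.1, hVp _ e.2⟩).2) = A ⟨e.1, hVp _ e.2⟩ :=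
            Prod.ext (Subtype.ext ((h' _).trans (hA ⟨e.1, hVp _ e.2⟩).symm)) rfl
          simp only [this, A.symm_apply_apply]
        right_inv v := by
          refine Prod.ext (Subtype.ext (hinv v.1 v.2)) (Subtype.ext ?_)
          simp
        continuous_toFun := by fun_prop
        continuous_invFun := by fun_prop }
  · exact fun e ↦ rfl

end Comp

/-! ### Construction of a covering with prescribed group -/

/-- An open cover of `X` indexed by its points together with classes of paths from `x` to all
points, chosen coherently modulo `N` on each member of the cover. -/
structure Frame (x : X) (N : Subgroup (FundamentalGroup X x)) where
  /-- The members of the cover. -/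
  nhd : X → Set X
  isOpen_nhd : ∀ i, IsOpen (nhd i)
  mem_nhd : ∀ i, i ∈ nhd i
  /-- The class of paths from `x` to a point attached to a member of the cover. -/
  ray : ∀ _ y : X, Path.Homotopic.Quotient x y
  coherent : ∀ (i y z : X) (δ : Path y z), Set.range δ ⊆ nhd i →
    (((ray i y).trans (.mk δ)).trans (ray i z).symm : FundamentalGroup X x) ∈ N

theorem nonempty_frame [PathConnectedSpace X] [LocallyPathConnectedSpace X] (x : X)
    {𝒰 : Set (Set X)} (h𝒰 : IsOpenCovering 𝒰) : Nonempty (Frame x (spanierGroupOf 𝒰 x)) := by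
  have hcov : ∀ i : X, ∃ U ∈ 𝒰, i ∈ U := fun i ↦ Set.mem_sUnion.mp (h𝒰.2.ge (Set.mem_univ i))
  choose U hU hiU using hcov
  -- The ray goes to `i` by a fixed path and then stays in `U i`, so coherence yields a generator of
  -- `π(𝒰, x)`. Off the path component of `i` it is an arbitrary default.
  have hray : ∀ i y : X, ∃ r : Path.Homotopic.Quotient x y, y ∈ pathComponentIn (U i) i →
      ∃ γ : Path i y, Set.range γ ⊆ U i ∧
        r = (Path.Homotopic.Quotient.mk (PathConnectedSpace.somePath x i)).trans (.mk γ) := by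
    intro i y
    by_cases hy : y ∈ pathComponentIn (U i) i
    · obtain ⟨γ, hγ⟩ := hy
      exact ⟨_, fun _ ↦ ⟨γ, Set.range_subset_iff.mpr hγ, rfl⟩⟩
    · exact ⟨.mk (PathConnectedSpace.somePath x y), fun h ↦ (hy h).elim⟩
  choose r hr using hray
  refine ⟨⟨fun i ↦ pathComponentIn (U i) i, fun i ↦ (h𝒰.1 _ (hU i)).pathComponentIn i,
    fun i ↦ mem_pathComponentIn_self (hiU i), r, fun i y z δ hδ ↦ ?_⟩⟩
  obtain ⟨γ, hγ, hγr⟩ := hr i y (hδ ⟨0, δ.source⟩)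
  obtain ⟨γ', hγ', hγr'⟩ := hr i z (hδ ⟨1, δ.target⟩)
  rw [hγr, hγr']
  have hmem := transport_loopClass_mem (𝒰 := 𝒰) (.mk (PathConnectedSpace.somePath x i))
    ((γ.trans δ).trans γ'.symm) (hU i) ?_
  · refine Eq.mp (congrArg (· ∈ spanierGroupOf 𝒰 x) ?_) hmem
    rw [transport_apply]
    simp only [loopClass, FundamentalGroup.fromPath, FundamentalGroup.fromArrow,
      ← Quotient.mk_trans, ← Quotient.mk_symm, Path.trans_symm]
    simp only [Quotient.mk_trans, Quotient.mk_symm, Quotient.trans_assoc]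
  · simp only [Path.trans_range, Path.symm_range, Set.union_subset_iff]
    exact ⟨⟨hγ, hδ.trans pathComponentIn_subset⟩, hγ'⟩

namespace Frame

variable {N : Subgroup (FundamentalGroup X x)} (Φ : Frame x N)

/-- The loop at `x` that goes out along the ray of `i` and comes back along the ray of `j`. -/
noncomputable def change (i j y : X) : FundamentalGroup X x :=
  (Φ.ray i y).trans (Φ.ray j y).symm

/-- The coordinate, relative to the member `i` of the cover, of a class of paths from `x`. -/
noncomputable def coord (i : X) (a : Path.Homotopic.Quotient x y) : FundamentalGroup X x :=
  a.trans (Φ.ray i y).symm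

theorem change_self (i y : X) : Φ.change i i y = 1 :=
  Quotient.trans_symm _

theorem change_mul_coord (i j : X) (a : Path.Homotopic.Quotient x y) :
    Φ.change i j y * Φ.coord i a = Φ.coord j a := by
  change (a.trans (Φ.ray i y).symm).trans ((Φ.ray i y).trans (Φ.ray j y).symm) =
    a.trans (Φ.ray j y).symm
  rw [Quotient.trans_assoc, ← Quotient.trans_assoc _ (Φ.ray i y), Quotient.symm_trans,
    Quotient.refl_trans]

theorem change_mul_change (i j k y : X) :
    Φ.change j k y * Φ.change i j y = Φ.change i k y :=
  Φ.change_mul_coord j k (Φ.ray i y)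

theorem exists_coord_eq (i : X) (g : FundamentalGroup X x) :
    ∃ a : Path.Homotopic.Quotient x y, Φ.coord i a = g := by
  refine ⟨Quotient.trans g (Φ.ray i y), ?_⟩
  change (Quotient.trans g (Φ.ray i y)).trans (Φ.ray i y).symm = g
  rw [Quotient.trans_assoc, Quotient.trans_symm, Quotient.trans_refl]

theorem coord_trans (i : X) (a : Path.Homotopic.Quotient x y) {δ : Path y z}
    (hδ : Set.range δ ⊆ Φ.nhd i) : ∃ n ∈ N, Φ.coord i (a.trans (.mk δ)) = n * Φ.coord i a := by
  refine ⟨_, Φ.coherent i y z δ hδ, ?_⟩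
  change (a.trans (.mk δ)).trans (Φ.ray i z).symm =
    (a.trans (Φ.ray i y).symm).trans (((Φ.ray i y).trans (.mk δ)).trans (Φ.ray i z).symm)
  simp only [Quotient.trans_assoc]
  rw [← Quotient.trans_assoc _ (Φ.ray i y), Quotient.symm_trans, Quotient.refl_trans]

/-- Left multiplication by `n` is right multiplication by `g⁻¹ * n * g`, which lies in `N` by
normality and so is absorbed by `H`. -/
theorem mk_mul_of_mem [N.Normal] {H : Subgroup (FundamentalGroup X x)} (hN : N ≤ H)
    {n : FundamentalGroup X x} (hn : n ∈ N) (g : FundamentalGroup X x) :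
    ((n * g : FundamentalGroup X x) : FundamentalGroup X x ⧸ H) = g := by
  rw [eq_comm, QuotientGroup.eq]
  simpa only [mul_assoc] using hN (Subgroup.Normal.conj_mem' inferInstance n hn g)

theorem mk_coord_trans [N.Normal] {H : Subgroup (FundamentalGroup X x)} (hN : N ≤ H) (i : X)
    (a : Path.Homotopic.Quotient x y) {δ : Path y z} (hδ : Set.range δ ⊆ Φ.nhd i) :
    (Φ.coord i (a.trans (.mk δ)) : FundamentalGroup X x ⧸ H) = Φ.coord i a := by
  obtain ⟨n, hn, h⟩ := Φ.coord_trans i a hδ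
  rw [h, mk_mul_of_mem hN hn]

/-- Write `v` as the `i`-coordinate of a path class; the change turns it into the `j`-coordinate,
and neither coset changes when the path is prolonged by `δ`. Transition maps are thus locally
constant. -/
theorem change_smul_eq [N.Normal] {H : Subgroup (FundamentalGroup X x)} (hN : N ≤ H) (i j : X)
    {δ : Path y z} (hi : Set.range δ ⊆ Φ.nhd i) (hj : Set.range δ ⊆ Φ.nhd j)
    (v : FundamentalGroup X x ⧸ H) : Φ.change i j z • v = Φ.change i j y • v := by
  obtain ⟨g, rfl⟩ := QuotientGroup.mk_surjective v
  obtain ⟨a, rfl⟩ := Φ.exists_coord_eq (y := y) i g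
  rw [← Φ.mk_coord_trans hN i a hi, MulAction.Quotient.smul_mk, smul_eq_mul, Φ.change_mul_coord,
    Φ.mk_coord_trans hN j a hj, Φ.mk_coord_trans hN i a hi, MulAction.Quotient.smul_mk, smul_eq_mul,
    Φ.change_mul_coord]

variable [N.Normal] [LocallyPathConnectedSpace X] (H : Subgroup (FundamentalGroup X x)) (hN : N ≤ H)

/-- The discrete topology on the set of cosets, which is the fiber of the covering space. -/
local instance : TopologicalSpace (FundamentalGroup X x ⧸ H) := ⊥

/-- The gluing data of the covering space with group `H`. -/
noncomputable def core : FiberBundleCore X X (FundamentalGroup X x ⧸ H) where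
  baseSet := Φ.nhd
  isOpen_baseSet := Φ.isOpen_nhd
  indexAt := id
  mem_baseSet_at := Φ.mem_nhd
  coordChange i j y v := Φ.change i j y • v
  coordChange_self i y _ v := by rw [change_self, one_smul]
  continuousOn_coordChange i j := by
    have : DiscreteTopology (FundamentalGroup X x ⧸ H) := ⟨rfl⟩
    rintro ⟨y, v⟩ ⟨hy, -⟩
    refine ContinuousAt.continuousWithinAt ?_
    have hopen := ((Φ.isOpen_nhd i).inter (Φ.isOpen_nhd j)).pathComponentIn y
    have hnhds : pathComponentIn (Φ.nhd i ∩ Φ.nhd j) y ×ˢ {v} ∈ 𝓝 (y, v) :=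
      prod_mem_nhds (hopen.mem_nhds (mem_pathComponentIn_self hy)) (mem_nhds_discrete.mpr rfl)
    refine (continuousAt_const (y := Φ.change i j y • v)).congr ?_
    filter_upwards [hnhds]
    rintro ⟨z, w⟩ ⟨⟨δ, hδ⟩, rfl⟩
    exact (Φ.change_smul_eq hN i j (Set.range_subset_iff.mpr fun t ↦ (hδ t).1)
      (Set.range_subset_iff.mpr fun t ↦ (hδ t).2) w).symm
  coordChange_comp i j k y _ v := by rw [smul_smul, change_mul_change]

/-- The projection of the covering space with group `H`. -/
noncomputable def proj : C((Φ.core H hN).TotalSpace, X) :=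
  ⟨(Φ.core H hN).proj, (Φ.core H hN).continuous_proj⟩

theorem isCovering_proj : IsCovering (Φ.proj H hN) := by
  have : DiscreteTopology (FundamentalGroup X x ⧸ H) := ⟨rfl⟩
  exact ⟨FiberBundle.isCoveringMap (F := FundamentalGroup X x ⧸ H) (E := (Φ.core H hN).Fiber),
    fun y ↦ ⟨⟨y, ((1 : FundamentalGroup X x) : FundamentalGroup X x ⧸ H)⟩, rfl⟩⟩

/-- The point of the covering space with group `H` given by a class of paths from `x`. -/
noncomputable def point (a : Path.Homotopic.Quotient x y) : (Φ.core H hN).TotalSpace :=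
  ⟨y, (Φ.coord y a : FundamentalGroup X x ⧸ H)⟩

theorem exists_point_eq (e : (Φ.core H hN).TotalSpace) :
    ∃ (y : X) (a : Path.Homotopic.Quotient x y), Φ.point H hN a = e := by
  obtain ⟨y, v⟩ := e
  obtain ⟨g, rfl⟩ := QuotientGroup.mk_surjective (s := H) v
  obtain ⟨a, rfl⟩ := Φ.exists_coord_eq (y := y) y g
  exact ⟨y, a, rfl⟩

theorem localTriv_point (i : X) (a : Path.Homotopic.Quotient x y) :
    (Φ.core H hN).localTriv i (Φ.point H hN a) =
      (y, (Φ.coord i a : FundamentalGroup X x ⧸ H)) := by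
  refine Prod.ext rfl ?_
  change Φ.change y i y • (Φ.coord y a : FundamentalGroup X x ⧸ H) = _
  rw [MulAction.Quotient.smul_mk, smul_eq_mul, Φ.change_mul_coord]

theorem point_eq_point_iff (g h : FundamentalGroup X x) :
    Φ.point H hN (y := x) g = Φ.point H hN (y := x) h ↔ g⁻¹ * h ∈ H := by
  -- The ray enters as a common left factor, which cancels in `g⁻¹ * h`.
  have hcoord : ∀ k : FundamentalGroup X x,
      Φ.coord x (y := x) k = (show FundamentalGroup X x from Φ.ray x x)⁻¹ * k := fun k ↦ rfl
  refine (Bundle.TotalSpace.mk_inj (b := x) (E := (Φ.core H hN).Fiber)).trans ?_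
  refine (QuotientGroup.eq (s := H)).trans ?_
  rw [hcoord, hcoord, mul_inv_rev,
    inv_inv, mul_assoc, mul_inv_cancel_left]

theorem point_cast (a : Path.Homotopic.Quotient x y) (h : z = y) :
    Φ.point H hN (a.cast rfl h) = Φ.point H hN a := by
  subst h
  rw [Quotient.cast_rfl_rfl]

/-- In the trivialization around `γ t₀` the fiber coordinate is constant near `t₀`, since the piece
of `γ` from `t₀` to `t` stays in `Φ.nhd i`. -/
theorem continuous_point_subpath (γ : Path x y) :
    Continuous fun t ↦ Φ.point H hN (.mk ((γ.subpath 0 t).cast γ.source.symm rfl)) := by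
  refine continuous_iff_continuousAt.mpr fun t₀ ↦ ?_
  let i := γ t₀
  have hi : γ ⁻¹' Φ.nhd i ∈ 𝓝 t₀ :=
    γ.continuous.continuousAt.preimage_mem_nhds ((Φ.isOpen_nhd i).mem_nhds (Φ.mem_nhd i))
  refine (((Φ.core H hN).localTriv i).continuousAt_iff_continuousAt_comp_left ?_).mpr ?_
  · exact hi
  refine ContinuousAt.congr (f := fun t ↦ (γ t, (Φ.coord i (.mk ((γ.subpath 0 t₀).cast
    γ.source.symm rfl)) : FundamentalGroup X x ⧸ H))) (by fun_prop) ?_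
  have hev : ∀ᶠ t in 𝓝 t₀, Set.uIcc t₀ t ⊆ γ ⁻¹' Φ.nhd i :=
    (tendsto_const_nhds.uIcc Filter.tendsto_id).eventually
      (Filter.eventually_smallSets_subset.mpr hi)
  filter_upwards [hev] with t ht
  have hsub : Set.range (γ.subpath t₀ t) ⊆ Φ.nhd i := by
    rw [Path.range_subpath]
    exact Set.image_subset_iff.mpr ht
  have htrans : (Path.Homotopic.Quotient.mk ((γ.subpath 0 t₀).cast γ.source.symm rfl)).trans
      (.mk (γ.subpath t₀ t)) = .mk ((γ.subpath 0 t).cast γ.source.symm rfl) :=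
    Quotient.eq.mpr
      ((show Path.Homotopic _ _ from ⟨Path.Homotopy.subpathTransSubpath γ 0 t₀ t⟩).pathCast
        γ.source.symm rfl)
  change _ = (Φ.core H hN).localTriv i (Φ.point H hN _)
  rw [Φ.localTriv_point, ← htrans, Φ.mk_coord_trans hN i _ hsub]

/-- A path starting at `x` is lifted by the points given by its initial pieces. -/
theorem exists_path_point (γ : Path x y) :
    ∃ Γ : Path (Φ.point H hN (.refl x)) (Φ.point H hN (.mk γ)),
      ∀ t, Φ.proj H hN (Γ t) = γ t := by
  refine ⟨⟨⟨_, Φ.continuous_point_subpath H hN γ⟩, ?_, ?_⟩, fun t ↦ rfl⟩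
  · refine Eq.trans ?_ (Φ.point_cast H hN (.refl x) γ.source)
    refine congrArg (Φ.point H hN) (congrArg Path.Homotopic.Quotient.mk ?_)
    ext t
    simp
  · refine Eq.trans ?_ (Φ.point_cast H hN (.mk γ) γ.target)
    refine congrArg (Φ.point H hN) (congrArg Path.Homotopic.Quotient.mk ?_)
    ext t
    simp

theorem pathConnectedSpace_totalSpace : PathConnectedSpace (Φ.core H hN).TotalSpace := by
  have hjoin : ∀ e, Joined (Φ.point H hN (.refl x)) e := by
    intro e
    obtain ⟨y, a, rfl⟩ := Φ.exists_point_eq H hN e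
    induction a with | mk γ => ?_
    exact ⟨(Φ.exists_path_point H hN γ).choose⟩
  exact ⟨⟨Φ.point H hN (.refl x)⟩, fun e e' ↦ (hjoin e).symm.trans (hjoin e')⟩

/-- The lift of `γ` ends at the point given by the class of `γ`, which is the base point exactly
when that class is in `H`. -/
theorem range_mapOfEq_proj :
    (FundamentalGroup.mapOfEq (Φ.proj H hN) (x := Φ.point H hN (.refl x)) (y := x) rfl).range =
      H := by
  ext g
  obtain ⟨γ, rfl⟩ := loopClass_surjective g
  obtain ⟨Γ, hΓ⟩ := Φ.exists_path_point H hN γ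
  have hp := (Φ.isCovering_proj H hN).1
  have hmon : hp.monodromy (.mk γ) ⟨Φ.point H hN (.refl x), rfl⟩ = ⟨Φ.point H hN (.mk γ), rfl⟩ :=
    monodromy_mk_eq hp Γ hΓ
  refine (mem_range_mapOfEq_iff hp rfl).trans ?_
  refine Iff.trans ?_ ((Φ.point_eq_point_iff H hN 1 (loopClass γ)).trans (by rw [inv_one, one_mul]))
  refine (Eq.congr_left hmon).trans ?_
  exact Subtype.mk_eq_mk.trans eq_comm

end Frame

/-- If `H` contains the Spanier group of an open cover, then `H` is the group of a path connected
covering space. -/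
theorem exists_covering_of_spanierGroupOf_le [PathConnectedSpace X] [LocallyPathConnectedSpace X]
    {𝒰 : Set (Set X)} (h𝒰 : IsOpenCovering 𝒰) {H : Subgroup (FundamentalGroup X x)}
    (hH : spanierGroupOf 𝒰 x ≤ H) :
    ∃ (E : Type u) (_ : TopologicalSpace E) (p : C(E, X)) (e : E) (he : p e = x),
      PathConnectedSpace E ∧ IsCovering p ∧ (FundamentalGroup.mapOfEq p he).range = H := by
  obtain ⟨Φ⟩ := nonempty_frame x h𝒰
  let _ : TopologicalSpace (FundamentalGroup X x ⧸ H) := ⊥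
  exact ⟨(Φ.core H hH).TotalSpace, inferInstance, Φ.proj H hH, Φ.point H hH (.refl x), rfl,
    Φ.pathConnectedSpace_totalSpace H hH, Φ.isCovering_proj H hH, Φ.range_mapOfEq_proj H hH⟩

/-! ### Coverable spaces and universal coverings -/

theorem isCoverable_iff [PathConnectedSpace X] [LocallyPathConnectedSpace X] (x : X) :
    IsCoverable x ↔
      ∃ 𝒰 : Set (Set X), IsOpenCovering 𝒰 ∧ spanierGroupOf 𝒰 x ≤ spanierGroup x := by
  constructor
  · intro h
    obtain ⟨E, _, p, e, he, hp, hr⟩ := h (spanierGroup x) le_rfl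
    obtain ⟨𝒰, h𝒰, hle⟩ := exists_isOpenCovering_spanierGroupOf_le hp.1
    exact ⟨𝒰, h𝒰, hr ▸ hle x e he⟩
  · rintro ⟨𝒰, h𝒰, hle⟩ H hH
    obtain ⟨E, _, p, e, he, -, hp, hr⟩ := exists_covering_of_spanierGroupOf_le h𝒰 (hle.trans hH)
    exact ⟨E, _, p, e, he, hp, hr⟩

theorem exists_lift_of_range_le {A Y : Type u} [TopologicalSpace A] [TopologicalSpace Y]
    [PathConnectedSpace A] [LocallyPathConnectedSpace A] {p : C(A, X)} {q : C(Y, X)}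
    (hq : IsCoveringMap q) {a : A} {b : Y} (ha : p a = x) (hb : q b = x)
    (hle : (FundamentalGroup.mapOfEq p ha).range ≤ (FundamentalGroup.mapOfEq q hb).range) :
    ∃ f : C(A, Y), f a = b ∧ q.comp f = p := by
  subst ha
  obtain ⟨f, ⟨hfa, hf⟩, -⟩ := hq.existsUnique_continuousMap_lifts_of_range_le (f := p) hb <| by
    refine le_trans (le_of_eq ?_) hle
    ext g
    refine exists_congr fun γ ↦ Eq.congr_left ?_
    rw [FundamentalGroup.mapOfEq_apply]
    exact (Quotient.cast_rfl_rfl _).symm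
  exact ⟨f, hfa, ContinuousMap.ext fun e ↦ congr_fun hf e⟩

/-- A path connected covering whose group is normal has a covering transformation between any two
points of the same fiber. -/
theorem exists_homeomorph_of_normal {E : Type u} [TopologicalSpace E] [PathConnectedSpace E]
    [LocallyPathConnectedSpace E] {p : C(E, X)} (hp : IsCoveringMap p) {e e' : E}
    (he : p e = x) (he' : p e' = x) (hN : (FundamentalGroup.mapOfEq p he).range.Normal) :
    ∃ h : E ≃ₜ E, h e = e' ∧ ∀ a, p (h a) = p a := by
  -- By normality the groups at `e` and `e'` agree, so `p` lifts through itself in both directions;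
  -- uniqueness of lifts makes the two maps inverse.
  have hr := range_mapOfEq_eq_of_normal hp he rfl he'
  obtain ⟨f, hf, hpf⟩ := exists_lift_of_range_le hp he he' hr.ge
  obtain ⟨g, hg, hpg⟩ := exists_lift_of_range_le hp he' he hr.le
  have hpf' : ∀ a, p (f a) = p a := fun a ↦ congr($hpf a)
  have hpg' : ∀ a, p (g a) = p a := fun a ↦ congr($hpg a)
  have hgf : g ∘ f = id := hp.eq_of_comp_eq (g.continuous.comp f.continuous) continuous_id
    (funext fun a ↦ (hpg' _).trans (hpf' a)) e (by simp [hf, hg])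
  have hfg : f ∘ g = id := hp.eq_of_comp_eq (f.continuous.comp g.continuous) continuous_id
    (funext fun a ↦ (hpf' _).trans (hpg' a)) e' (by simp [hf, hg])
  exact ⟨⟨⟨f, g, congr_fun hgf, congr_fun hfg⟩, f.continuous, g.continuous⟩, hf, hpf'⟩

/-- A universal covering lies over the covering with group `π(𝒱, x)` for every `𝒱`, so its group is
contained in `π₁ˢᵖ(X, x)`. Conversely, the covering with group `π₁ˢᵖ(X, x)` has the least possible
group, hence maps to every other one. -/
theorem hasUniversalCovering_iff [PathConnectedSpace X] [LocallyPathConnectedSpace X] (x : X) :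
    HasUniversalCovering X ↔
      ∃ 𝒰 : Set (Set X), IsOpenCovering 𝒰 ∧ spanierGroupOf 𝒰 x ≤ spanierGroup x := by
  constructor
  · rintro ⟨E, _, p, hp, huniv⟩
    obtain ⟨e, he⟩ := hp.2 x
    obtain ⟨𝒰, h𝒰, hle⟩ := exists_isOpenCovering_spanierGroupOf_le hp.1
    refine ⟨𝒰, h𝒰, (hle x e he).trans (le_iInf₂ fun 𝒱 h𝒱 ↦ ?_)⟩
    obtain ⟨Y, _, q, b, hb, _, hq, hr⟩ :=
      exists_covering_of_spanierGroupOf_le h𝒱 (le_refl (spanierGroupOf 𝒱 x))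
    obtain ⟨⟨f, -, hf⟩, -⟩ := huniv Y q hq
    have hqf : ∀ a, q (f a) = p a := fun a ↦ congr($hf a)
    rw [← range_mapOfEq_eq_of_normal hq.1 hb hr ((hqf e).trans he)]
    intro g hg
    obtain ⟨γ, rfl⟩ := loopClass_surjective g
    rw [mem_range_mapOfEq_iff hp.1] at hg
    obtain ⟨Γ, hΓ⟩ := exists_lift hp.1 γ ⟨e, he⟩
    refine (mem_range_mapOfEq_iff hq.1 _).mpr ?_
    exact monodromy_mk_eq hq.1 ((Γ.map f.continuous).cast rfl congr(f $(hg).1).symm)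
      fun t ↦ (hqf _).trans (hΓ t)
  · rintro ⟨𝒰, h𝒰, hle⟩
    obtain ⟨E, _, p, e, he, _, hp, hr⟩ := exists_covering_of_spanierGroupOf_le h𝒰 hle
    have := locallyPathConnectedSpace_of_isLocalHomeomorph hp.1.isLocalHomeomorph
    refine ⟨E, _, p, hp, fun Y _ _ q hq ↦ ⟨?_, fun f f' hf hf' hqf hqf' ↦ ?_⟩⟩
    · obtain ⟨b, hb⟩ := hq.2 x
      obtain ⟨f, -, hf⟩ := exists_lift_of_range_le hq.1 he hb
        (hr.le.trans (spanierGroup_le_range hq.1 hb))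
      have hsurj := surjective_of_comp_eq hp.1 hq.1 hf
      exact ⟨f, ⟨isCoveringMap_of_comp_eq hp.1 hq.1 hf hsurj, hsurj⟩, hf⟩
    -- A covering transformation taking `e` to `e'` makes `f' ∘ h` and `f` agree at `e`, hence
    -- everywhere.
    · obtain ⟨e', he'⟩ := hf'.2 (f e)
      have hpe' : p e' = x :=
        ((congr($hqf' e').symm.trans congr(q $he')).trans congr($hqf e)).trans he
      obtain ⟨h, hh, hph⟩ := exists_homeomorph_of_normal hp.1 he hpe' (hr ▸ inferInstance)
      refine ⟨h, congr_fun (hq.1.eq_of_comp_eq (f'.continuous.comp h.continuous) f.continuous ?_ e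
        (by simp [hh, he']))⟩
      exact funext fun a ↦ (congr($hqf' (h a)).trans (hph a)).trans congr($hqf a).symm

/-! ### Topologies on the fundamental group -/

theorem isOpen_quotientTopology_iff {s : Set (FundamentalGroup X x)} :
    IsOpen[quotientTopology x] s ↔ IsOpen {γ : Path x x | loopClass γ ∈ s} :=
  isOpen_coinduced

/-- Every neighborhood of the constant loop at `y` contains all loops at `y` inside some
neighborhood of `y`. -/
theorem exists_isOpen_of_mem_nhds_refl {s : Set (Path y y)} (hs : s ∈ 𝓝 (Path.refl y)) :
    ∃ U : Set X, IsOpen U ∧ y ∈ U ∧ ∀ β : Path y y, Set.range β ⊆ U → β ∈ s := by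
  let l : Filter (Path y y) := (𝓝 y).smallSets.comap fun β : Path y y ↦ Set.range β
  have hl : Filter.Tendsto id l (𝓝 (Path.refl y)) := by
    rw [nhds_induced, Filter.tendsto_comap_iff, ContinuousMap.tendsto_nhds_compactOpen]
    intro K _ U hU hKU
    rcases K.eq_empty_or_nonempty with rfl | ⟨t, ht⟩
    · exact Filter.Eventually.of_forall fun β ↦ Set.mapsTo_empty _ _
    · have hyU : y ∈ U := hKU ht
      have : ∀ᶠ β : Path y y in l, Set.range β ⊆ U :=
        Filter.tendsto_comap.eventually
          (Filter.eventually_smallSets_subset.mpr (hU.mem_nhds hyU))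
      filter_upwards [this] with β hβ t _ using hβ ⟨t, rfl⟩
  obtain ⟨t, ht, hts⟩ := Filter.mem_comap.mp (hl hs)
  obtain ⟨V, hV, hVt⟩ := (Filter.hasBasis_smallSets _).mem_iff.mp ht
  obtain ⟨U, hUV, hU, hyU⟩ := mem_nhds_iff.mp hV
  exact ⟨U, hU, hyU, fun β hβ ↦ hts (hVt (hβ.trans hUV))⟩

theorem isOpen_spanierGroup_quotientTopology_iff [PathConnectedSpace X]
    [LocallyPathConnectedSpace X] (x : X) :
    IsOpen[quotientTopology x] (spanierGroup x : Set (FundamentalGroup X x)) ↔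
      IsSemilocallySpanier X := by
  constructor
  · intro h y
    rw [isOpen_quotientTopology_iff] at h
    let α := PathConnectedSpace.somePath x y
    -- Conjugation by `α` moves the open set of loops at `x` to a neighborhood of the constant loop
    -- at `y`.
    have hcont : Continuous fun β : Path y y ↦ (α.trans β).trans α.symm := by fun_prop
    obtain ⟨U, hU, hyU, hβ⟩ := exists_isOpen_of_mem_nhds_refl (y := y) <|
      (h.preimage hcont).mem_nhds <| (transport_mem_spanierGroup_iff (.mk α)).mpr
        (one_mem (spanierGroup y))
    exact ⟨U, hyU, hU, (inclusionImage_le hyU).mpr fun β h ↦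
      (transport_mem_spanierGroup_iff (.mk α)).mp (hβ β h)⟩
  · intro h
    obtain ⟨E, _, p, e, he, hp, hr⟩ :=
      (isCoverable_iff x).mpr ((isSemilocallySpanier_iff x).mp h) _ le_rfl
    rw [isOpen_quotientTopology_iff, ← hr]
    exact isOpen_setOf_loopClass_mem_range hp.1 he

/-- For normal subgroups, being open in `π₁^qtop` and in `π₁^τ` are the same. -/
theorem isOpen_groupTopology_iff (N : Subgroup (FundamentalGroup X x)) [N.Normal] :
    IsOpen[(groupTopology x).toTopologicalSpace] (N : Set (FundamentalGroup X x)) ↔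
      IsOpen[quotientTopology x] (N : Set (FundamentalGroup X x)) := by
  constructor
  · intro h
    have hc := GroupTopology.coinduced_continuous (loopClass : Path x x → FundamentalGroup X x)
    exact continuous_iff_coinduced_le.mp hc _ h
  · intro h
    rw [isOpen_quotientTopology_iff] at h
    let _ : TopologicalSpace (FundamentalGroup X x ⧸ N) := ⊥
    have : DiscreteTopology (FundamentalGroup X x ⧸ N) := ⟨rfl⟩
    -- Pulling back the discrete topology of the quotient by `N` gives a group topology in which `N`
    -- is open. It suffices that loops map continuously to it, as `groupTopology x` is then finer.
    let T : GroupTopology (FundamentalGroup X x) :=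
      { toTopologicalSpace := TopologicalSpace.induced (QuotientGroup.mk' N) inferInstance
        toIsTopologicalGroup := topologicalGroup_induced (QuotientGroup.mk' N) }
    have hT : quotientTopology x ≤ T.toTopologicalSpace := by
      refine continuous_iff_coinduced_le.mp (continuous_induced_rng.mpr ?_)
      refine (IsLocallyConstant.iff_exists_open _).mpr (fun γ ↦ ?_) |>.continuous
      -- The preimage of `N` under this map is the set of loops with class in the coset of `γ`.
      have hc : Continuous fun δ : Path x x ↦ δ.trans γ.symm := by fun_prop
      refine ⟨_, h.preimage hc, ?_, fun δ hδ ↦ ?_⟩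
      · have h1 : (loopClass γ)⁻¹ * loopClass γ ∈ N := by
          rw [inv_mul_cancel]
          exact one_mem N
        exact h1
      · have h1 : (loopClass γ)⁻¹ * loopClass δ ∈ N := hδ
        exact (QuotientGroup.eq.mpr h1).symm
    have hle : groupTopology x ≤ T := sInf_le hT
    refine TopologicalSpace.le_def.mp (GroupTopology.toTopologicalSpace_le.mpr hle) _ ?_
    refine ⟨{1}, isOpen_discrete _, ?_⟩
    ext g
    exact QuotientGroup.eq_one_iff g

end SpanierCovering

theorem theorem1 {X : Type u} [TopologicalSpace X] [ConnectedSpace X] [LocallyPathConnectedSpace X]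
    (x : X) :
    List.TFAE [
      SpanierCovering.IsCoverable x,
      SpanierCovering.HasUniversalCovering X,
      ∃ 𝒰 : Set (Set X), SpanierCovering.IsPiStable 𝒰,
      SpanierCovering.IsSemilocallySpanier X,
      ∀ y : X, ¬ SpanierCovering.IsWildPoint y,
      IsOpen[SpanierCovering.quotientTopology x]
        (SpanierCovering.spanierGroup x : Set (FundamentalGroup X x)),
      IsOpen[(SpanierCovering.groupTopology x).toTopologicalSpace]
        (SpanierCovering.spanierGroup x : Set (FundamentalGroup X x))] := by
  have : PathConnectedSpace X := .of_locallyPathConnectedSpace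
  tfae_have 1 ↔ 4 := (SpanierCovering.isCoverable_iff x).trans
    (SpanierCovering.isSemilocallySpanier_iff x).symm
  tfae_have 2 ↔ 4 := (SpanierCovering.hasUniversalCovering_iff x).trans
    (SpanierCovering.isSemilocallySpanier_iff x).symm
  tfae_have 3 ↔ 4 := (SpanierCovering.exists_isPiStable_iff x).trans
    (SpanierCovering.isSemilocallySpanier_iff x).symm
  tfae_have 4 ↔ 5 := SpanierCovering.isSemilocallySpanier_iff_forall_not_isWildPoint
  tfae_have 6 ↔ 4 := SpanierCovering.isOpen_spanierGroup_quotientTopology_iff x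
  tfae_have 7 ↔ 6 := SpanierCovering.isOpen_groupTopology_iff (SpanierCovering.spanierGroup x)
  tfae_finish
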